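/- Let $n\ge 0$. An alternating sign matrix (ASM) of order $n$ is an $n\times n$ matrix with entries in $\{-1,0,1\}$ whose rows and columns sum to $1$ and in which the nonzero entries alternate in sign along each row and each column. Its height function matrix is $H_{i,j}=i+j-2\sum_{i'\le i,\,j'\le j}A_{i',j'}$ for $0\le i,j\le n$. Ordering ASMs by entrywise comparison of their height function matrices gives a finite distributive lattice $\mathbf{ASM}_n$. An ASM is permutational if it is a permutation matrix. Let $\mathcal J(\mathbf{ASM}_n)$ be the set of join irreducibles, that is, of the elements $j$ covering exactly one element $j_\star$. For an ASM $A$, let $\operatorname j(A)$ be the set of maximal elements of $\{J\in\mathcal J(\mathbf{ASM}_n) : J\le A\}$ (its canonical join representation). For a lattice congruence $\equiv$ of $\mathbf{ASM}_n$, let $\mathcal J(\equiv)=\{j\in\mathcal J(\mathbf{ASM}_n) : j\not\equiv j_\star\}$. (1) For every non-permutational ASM $A$ there is a non-permutational ASM $A'$ with $|\operatorname j(A')|=2$ and $\operatorname j(A')\subseteq\operatorname j(A)$. (2) For every lattice congruence $\equiv$ of $\mathbf{ASM}_n$, the following conditions are equivalent: (a) the minima of the congruence classes of $\equiv$ are all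 permutational; (b) $\operatorname j(A)\not\subseteq\mathcal J(\equiv)$ for each non-permutational ASM $A$ with $|\operatorname j(A)|=2$; (c) $\mathcal J(\mathbf{ASM}_n)\smallsetminus\mathcal J(\equiv)$ is a vertex cover of the graph on $\mathcal J(\mathbf{ASM}_n)$ with an edge $\{J,J'\}$ (for $J\ne J'$) if and only if $J\vee J'$ is non-permutational. (3) Let $n\ge 3$ and let $\equiv$ be a catalan congruence of $\mathbf{ASM}_n$, that is, a lattice congruence whose quotient is isomorphic to the Stanley lattice of Dyck paths of semilength $n$, ordered by $P\le Q$ if $P$ stays weakly below $Q$. Then at least one congruence class of $\equiv$ has a non-permutational minimum. -/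

import Mathlib

namespace AltSign

/-! ### Alternating sequences and partial sums -/

/-- A sequence with entries in `{-1, 0, 1}` and sum `1` whose nonzero entries alternate in sign:
two nonzero entries with only zeros in between are opposite. -/
structure IsAlternating {n : ℕ} (a : Fin n → ℤ) : Prop where
  entry : ∀ i, a i = -1 ∨ a i = 0 ∨ a i = 1
  sum_eq : ∑ i, a i = 1
  alternate : ∀ p q, p < q → a p ≠ 0 → a q ≠ 0 → (∀ r, p < r → r < q → a r = 0) → a q = -a p

/-- The sum of the first `j` entries of a sequence. -/
def partialSum {n : ℕ} (a : Fin n → ℤ) (j : Fin (n + 1)) : ℤ :=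
  ∑ k with k.castSucc < j, a k

theorem partialSum_zero {n : ℕ} (a : Fin n → ℤ) : partialSum a 0 = 0 := by
  simp [partialSum]

theorem partialSum_last {n : ℕ} (a : Fin n → ℤ) : partialSum a (Fin.last n) = ∑ k, a k := by
  simp [partialSum, Fin.castSucc_lt_last]

theorem partialSum_succ {n : ℕ} (a : Fin n → ℤ) (j : Fin n) :
    partialSum a j.succ = partialSum a j.castSucc + a j := by
  unfold partialSum
  have h : (Finset.univ.filter fun k : Fin n => k.castSucc < j.succ)
      = insert j (Finset.univ.filter fun k : Fin n => k.castSucc < j.castSucc) := by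
    ext k
    simp only [Finset.mem_filter, Finset.mem_univ, true_and, Finset.mem_insert, Fin.lt_def,
      Fin.val_castSucc, Fin.val_succ, Fin.ext_iff]
    omega
  rw [h, Finset.sum_insert (by simp), add_comm]

theorem alternating_interval (a : ℕ → ℤ) (h1 : ∀ i, a i = -1 ∨ a i = 0 ∨ a i = 1)
    (halt : ∀ p q, p < q → a p ≠ 0 → a q ≠ 0 → (∀ r, p < r → r < q → a r = 0) → a q = -a p)
    (k d : ℕ) :
    ((∀ i, k ≤ i → i < k + d → a i = 0) ∧ ∑ i ∈ Finset.Ico k (k + d), a i = 0) ∨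
    ∃ m, k ≤ m ∧ m < k + d ∧ (∀ r, m < r → r < k + d → a r = 0) ∧
      ((a m = 1 ∧ (∑ i ∈ Finset.Ico k (k + d), a i = 0 ∨ ∑ i ∈ Finset.Ico k (k + d), a i = 1)) ∨
      (a m = -1 ∧
        (∑ i ∈ Finset.Ico k (k + d), a i = 0 ∨ ∑ i ∈ Finset.Ico k (k + d), a i = -1))) := by
  induction d with
  | zero => left; simp; intros; omega
  | succ d ih =>
    rw [← add_assoc, Finset.sum_Ico_succ_top (by omega)]
    generalize ∑ i ∈ Finset.Ico k (k + d), a i = S at ih ⊢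
    by_cases h0 : a (k + d) = 0
    · rcases ih with ⟨hz, hs⟩ | ⟨m, hm1, hm2, hz, hs⟩
      · left
        refine ⟨fun i hi hi' => ?_, by omega⟩
        rcases Nat.lt_succ_iff_lt_or_eq.mp hi' with h | h
        · exact hz i hi h
        · rw [h]; exact h0
      · right
        refine ⟨m, hm1, by omega, fun i hi hi' => ?_, by omega⟩
        rcases Nat.lt_succ_iff_lt_or_eq.mp hi' with h | h
        · exact hz i hi h
        · rw [h]; exact h0
    · right
      refine ⟨k + d, by omega, by omega, fun i hi hi' => by omega, ?_⟩
      have h1' := h1 (k + d)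
      rcases ih with ⟨hz, hs⟩ | ⟨m, hm1, hm2, hz, hs⟩
      · omega
      · have := halt m (k + d) hm2 (by omega) h0 hz
        omega

theorem IsAlternating.partialSum_eq {n : ℕ} {a : Fin n → ℤ} (h : IsAlternating a)
    (j : Fin (n + 1)) : partialSum a j = 0 ∨ partialSum a j = 1 := by
  let b : ℕ → ℤ := fun i => if hi : i < n then a ⟨i, hi⟩ else 0
  have hb : ∀ i : Fin n, b i = a i := fun i => by simp [b]
  have hb1 : ∀ i, b i = -1 ∨ b i = 0 ∨ b i = 1 := by
    intro i
    by_cases hi : i < n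
    · simpa [b, hi] using h.entry ⟨i, hi⟩
    · simp [b, hi]
  have hb2 : ∀ p q, p < q → b p ≠ 0 → b q ≠ 0 → (∀ r, p < r → r < q → b r = 0) → b q = -b p := by
    intro p q hpq hp hq hr
    have hqn : q < n := by
      by_contra hc
      simp [b, hc] at hq
    have hpn : p < n := by omega
    have := h.alternate ⟨p, hpn⟩ ⟨q, hqn⟩ hpq (by rwa [← hb]) (by rwa [← hb])
      (fun r h1 h2 => by rw [← hb]; exact hr r h1 h2)
    rw [← hb, ← hb] at this
    exact this
  have hs : ∀ j : Fin (n + 1), partialSum a j = ∑ i ∈ Finset.Ico 0 (j : ℕ), b i := by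
    intro j
    induction j using Fin.induction with
    | zero => simp [partialSum_zero]
    | succ j ih =>
      rw [partialSum_succ, ih, Fin.val_succ, Finset.sum_Ico_succ_top (by omega), hb]
      rfl
  have hj : (j : ℕ) ≤ n := Nat.lt_succ_iff.mp j.isLt
  have e1 := alternating_interval b hb1 hb2 0 j
  have e2 := alternating_interval b hb1 hb2 j (n - j)
  have e3 := Finset.sum_Ico_consecutive b (Nat.zero_le j) hj
  have e4 := hs (Fin.last n)
  rw [partialSum_last, h.sum_eq, Fin.val_last] at e4
  rw [Nat.add_sub_cancel' hj] at e2
  rw [zero_add] at e1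
  rw [hs j]
  generalize ∑ i ∈ Finset.Ico 0 (j : ℕ), b i = S at *
  generalize ∑ i ∈ Finset.Ico (j : ℕ) n, b i = T at *
  generalize ∑ i ∈ Finset.Ico 0 n, b i = U at *
  have f1 : S = 0 ∨ S = 1 ∨ S = -1 := by
    rcases e1 with ⟨-, h⟩ | ⟨_, -, -, -, h⟩ <;> omega
  have f2 : T = 0 ∨ T = 1 ∨ T = -1 := by
    rcases e2 with ⟨-, h⟩ | ⟨_, -, -, -, h⟩ <;> omega
  omega

theorem isAlternating_of_partialSum {n : ℕ} {a : Fin n → ℤ}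
    (h : ∀ j, partialSum a j = 0 ∨ partialSum a j = 1) (h1 : ∑ i, a i = 1) : IsAlternating a where
  entry i := by
    have e := partialSum_succ a i
    have e1 := h i.succ
    have e2 := h i.castSucc
    omega
  sum_eq := h1
  alternate := by
    intro p q hpq hp hq hr
    have key : ∀ j : Fin (n + 1), p.castSucc < j → j ≤ q.castSucc →
        partialSum a j = partialSum a p.succ := by
      intro j
      induction j using Fin.induction with
      | zero => intro h0; exact absurd h0 (Fin.not_lt_zero _)
      | succ j ih =>
        intro hj1 hj2
        by_cases hjp : j = p
        · rw [hjp]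
        · have hpj : p < j := by
            simp only [Fin.lt_def, Fin.le_def, Fin.val_castSucc, Fin.val_succ, Fin.ext_iff] at *
            omega
          have hjq : j < q := by
            simp only [Fin.lt_def, Fin.le_def, Fin.val_castSucc, Fin.val_succ, Fin.ext_iff] at *
            omega
          rw [partialSum_succ, hr j hpj hjq, add_zero]
          exact ih hpj (le_of_lt hjq)
    have e := key q.castSucc hpq le_rfl
    have e1 := partialSum_succ a p
    have e2 := partialSum_succ a q
    have := h p.castSucc
    have := h p.succ
    have := h q.castSucc
    have := h q.succ
    omega

/-! ### Alternating sign matrices and height function matrices -/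

/-- Alternating sign matrices of order `n` (rows and columns are indexed by `0, …, n - 1`). -/
@[ext]
structure ASM (n : ℕ) where
  mat : Matrix (Fin n) (Fin n) ℤ
  row : ∀ i, IsAlternating fun j => mat i j
  col : ∀ j, IsAlternating fun i => mat i j

/-- Height function matrices of order `n` (rows and columns are indexed by `0, …, n`). -/
@[ext]
structure HFM (n : ℕ) where
  val : Fin (n + 1) → Fin (n + 1) → ℤ
  first_row : ∀ j, val 0 j = (j : ℤ)
  first_col : ∀ i, val i 0 = (i : ℤ)
  last_row : ∀ j, val (Fin.last n) j = (n : ℤ) - (j : ℤ)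
  last_col : ∀ i, val i (Fin.last n) = (n : ℤ) - (i : ℤ)
  row_step : ∀ i (j : Fin n), |val i j.succ - val i j.castSucc| = 1
  col_step : ∀ (i : Fin n) j, |val i.succ j - val i.castSucc j| = 1

theorem HFM.parity {n : ℕ} (H : HFM n) (i j : Fin (n + 1)) :
    H.val i j % 2 = ((i : ℤ) + (j : ℤ)) % 2 := by
  induction j using Fin.induction with
  | zero => simp [H.first_col]
  | succ j ih =>
    have := H.row_step i j
    rw [abs_eq (by norm_num)] at this
    simp only [Fin.val_succ, Fin.val_castSucc, Nat.cast_add, Nat.cast_one] at *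
    omega

/-- Height function matrices are ordered entrywise. -/
noncomputable instance {n : ℕ} : PartialOrder (HFM n) := PartialOrder.lift HFM.val fun _ _ => HFM.ext

/-- The join is the entrywise maximum and the meet is the entrywise minimum. -/
noncomputable instance {n : ℕ} : Lattice (HFM n) where
  sup H K :=
    { val := fun i j => max (H.val i j) (K.val i j)
      first_row := fun j => by rw [H.first_row, K.first_row, max_self]
      first_col := fun j => by rw [H.first_col, K.first_col, max_self]
      last_row := fun j => by rw [H.last_row, K.last_row, max_self]
      last_col := fun j => by rw [H.last_col, K.last_col, max_self]
      row_step := fun i j => by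
        have h1 := H.row_step i j
        have h2 := K.row_step i j
        have h3 := H.parity i j.castSucc
        have h4 := K.parity i j.castSucc
        rw [abs_eq (by norm_num)] at *
        omega
      col_step := fun i j => by
        have h1 := H.col_step i j
        have h2 := K.col_step i j
        have h3 := H.parity i.castSucc j
        have h4 := K.parity i.castSucc j
        rw [abs_eq (by norm_num)] at *
        omega }
  inf H K :=
    { val := fun i j => min (H.val i j) (K.val i j)
      first_row := fun j => by rw [H.first_row, K.first_row, min_self]
      first_col := fun j => by rw [H.first_col, K.first_col, min_self]
      last_row := fun j => by rw [H.last_row, K.last_row, min_self]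
      last_col := fun j => by rw [H.last_col, K.last_col, min_self]
      row_step := fun i j => by
        have h1 := H.row_step i j
        have h2 := K.row_step i j
        have h3 := H.parity i j.castSucc
        have h4 := K.parity i j.castSucc
        rw [abs_eq (by norm_num)] at *
        omega
      col_step := fun i j => by
        have h1 := H.col_step i j
        have h2 := K.col_step i j
        have h3 := H.parity i.castSucc j
        have h4 := K.parity i.castSucc j
        rw [abs_eq (by norm_num)] at *
        omega }
  le_sup_left _ _ := fun _ _ => le_max_left _ _
  le_sup_right _ _ := fun _ _ => le_max_right _ _
  sup_le _ _ _ h1 h2 := fun i j => max_le (h1 i j) (h2 i j)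
  inf_le_left _ _ := fun _ _ => min_le_left _ _
  inf_le_right _ _ := fun _ _ => min_le_right _ _
  le_inf _ _ _ h1 h2 := fun i j => le_min (h1 i j) (h2 i j)

/-- The corner sum matrix: `cornerSum A i j` is the sum of the entries of `A` lying in its first
`i` rows and its first `j` columns. -/
def cornerSum {n : ℕ} (A : Matrix (Fin n) (Fin n) ℤ) (i j : Fin (n + 1)) : ℤ :=
  ∑ k with k.castSucc < i, ∑ l with l.castSucc < j, A k l

theorem cornerSum_rows {n : ℕ} (A : Matrix (Fin n) (Fin n) ℤ) (i j : Fin (n + 1)) :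
    cornerSum A i j = partialSum (fun k => partialSum (fun l => A k l) j) i := rfl

theorem cornerSum_cols {n : ℕ} (A : Matrix (Fin n) (Fin n) ℤ) (i j : Fin (n + 1)) :
    cornerSum A i j = partialSum (fun l => partialSum (fun k => A k l) i) j :=
  Finset.sum_comm

theorem partialSum_one {n : ℕ} (j : Fin (n + 1)) : partialSum (fun _ : Fin n => 1) j = j := by
  induction j using Fin.induction with
  | zero => simp [partialSum_zero]
  | succ j ih => rw [partialSum_succ, ih]; simp

/-- The height function matrix `H i j = i + j - 2 C i j` of an alternating sign matrix with corner
sum matrix `C`. -/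
def ASM.toHFM {n : ℕ} (A : ASM n) : HFM n where
  val i j := (i : ℤ) + (j : ℤ) - 2 * cornerSum A.mat i j
  first_row j := by simp [cornerSum_rows, partialSum_zero]
  first_col i := by simp [cornerSum_cols, partialSum_zero]
  last_row j := by
    have : cornerSum A.mat (Fin.last n) j = j := by
      simp only [cornerSum_cols, partialSum_last, (A.col _).sum_eq, partialSum_one]
    rw [this, Fin.val_last]; ring
  last_col i := by
    have : cornerSum A.mat i (Fin.last n) = i := by
      simp only [cornerSum_rows, partialSum_last, (A.row _).sum_eq, partialSum_one]
    rw [this, Fin.val_last]; ring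
  row_step i j := by
    have e := partialSum_succ (fun l => partialSum (fun k => A.mat k l) i) j
    rw [← cornerSum_cols, ← cornerSum_cols] at e
    have e1 := (A.col j).partialSum_eq i
    rw [abs_eq (by norm_num)]
    simp only [Fin.val_succ, Fin.val_castSucc, Nat.cast_add, Nat.cast_one]
    omega
  col_step i j := by
    have e := partialSum_succ (fun k => partialSum (fun l => A.mat k l) j) i
    rw [← cornerSum_rows, ← cornerSum_rows] at e
    have e1 := (A.row i).partialSum_eq j
    rw [abs_eq (by norm_num)]
    simp only [Fin.val_succ, Fin.val_castSucc, Nat.cast_add, Nat.cast_one]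
    omega

/-- The matrix recovered from a height function matrix. -/
def HFM.toMatrix {n : ℕ} (H : HFM n) : Matrix (Fin n) (Fin n) ℤ := fun i j =>
  (H.val i.castSucc j.succ + H.val i.succ j.castSucc
    - H.val i.castSucc j.castSucc - H.val i.succ j.succ) / 2

theorem HFM.two_mul_toMatrix {n : ℕ} (H : HFM n) (i j : Fin n) :
    2 * H.toMatrix i j = H.val i.castSucc j.succ + H.val i.succ j.castSucc
      - H.val i.castSucc j.castSucc - H.val i.succ j.succ := by
  have h1 := H.parity i.castSucc j.castSucc
  have h2 := H.parity i.castSucc j.succ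
  have h3 := H.parity i.succ j.castSucc
  have h4 := H.parity i.succ j.succ
  simp only [Fin.val_succ, Fin.val_castSucc, Nat.cast_add, Nat.cast_one] at *
  unfold HFM.toMatrix
  omega

theorem HFM.two_mul_partialSum_row {n : ℕ} (H : HFM n) (i : Fin n) (j : Fin (n + 1)) :
    2 * partialSum (fun l => H.toMatrix i l) j = 1 + H.val i.castSucc j - H.val i.succ j := by
  induction j using Fin.induction with
  | zero => simp [partialSum_zero, H.first_col, add_comm]
  | succ j ih =>
    rw [partialSum_succ, mul_add, ih, H.two_mul_toMatrix]
    ring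

theorem HFM.two_mul_partialSum_col {n : ℕ} (H : HFM n) (j : Fin n) (i : Fin (n + 1)) :
    2 * partialSum (fun k => H.toMatrix k j) i = 1 + H.val i j.castSucc - H.val i j.succ := by
  induction i using Fin.induction with
  | zero => simp [partialSum_zero, H.first_row, add_comm]
  | succ i ih =>
    rw [partialSum_succ, mul_add, ih, H.two_mul_toMatrix]
    ring

/-- The alternating sign matrix of a height function matrix. -/
def HFM.toASM {n : ℕ} (H : HFM n) : ASM n where
  mat := H.toMatrix
  row i := by
    have e := H.two_mul_partialSum_row i
    refine isAlternating_of_partialSum (fun j => ?_) ?_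
    · have e1 := H.col_step i j
      rw [abs_eq (by norm_num)] at e1
      have e2 := e j
      omega
    · have e1 := e (Fin.last n)
      rw [partialSum_last, H.last_col, H.last_col] at e1
      simp only [Fin.val_succ, Fin.val_castSucc, Nat.cast_add, Nat.cast_one] at e1
      omega
  col j := by
    have e := H.two_mul_partialSum_col j
    refine isAlternating_of_partialSum (fun i => ?_) ?_
    · have e1 := H.row_step i j
      rw [abs_eq (by norm_num)] at e1
      have e2 := e i
      omega
    · have e1 := e (Fin.last n)
      rw [partialSum_last, H.last_row, H.last_row] at e1
      simp only [Fin.val_succ, Fin.val_castSucc, Nat.cast_add, Nat.cast_one] at e1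
      omega

theorem HFM.two_mul_cornerSum {n : ℕ} (H : HFM n) (i j : Fin (n + 1)) :
    2 * cornerSum H.toMatrix i j = (i : ℤ) + (j : ℤ) - H.val i j := by
  rw [cornerSum_rows]
  induction i using Fin.induction with
  | zero => simp [partialSum_zero, H.first_row, add_comm]
  | succ i ih =>
    rw [partialSum_succ, mul_add, ih, H.two_mul_partialSum_row]
    simp only [Fin.val_succ, Fin.val_castSucc, Nat.cast_add, Nat.cast_one]
    ring

/-- The bijection between alternating sign matrices and height function matrices. -/
def asmEquivHFM (n : ℕ) : ASM n ≃ HFM n where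
  toFun := ASM.toHFM
  invFun := HFM.toASM
  left_inv A := by
    apply ASM.ext
    funext i j
    have h := A.toHFM.two_mul_toMatrix i j
    have e0 := partialSum_succ (fun k => partialSum (fun l => A.mat k l) j.castSucc) i
    have e1 := partialSum_succ (fun k => partialSum (fun l => A.mat k l) j.succ) i
    have e2 := partialSum_succ (fun l => A.mat i l) j
    simp only [← cornerSum_rows] at e0 e1
    simp only [ASM.toHFM, Fin.val_succ, Fin.val_castSucc, Nat.cast_add, Nat.cast_one] at h
    change A.toHFM.toMatrix i j = A.mat i j
    simp only [ASM.toHFM]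
    omega
  right_inv H := by
    apply HFM.ext
    funext i j
    change (i : ℤ) + (j : ℤ) - 2 * cornerSum H.toMatrix i j = H.val i j
    rw [H.two_mul_cornerSum]
    ring

/-- Alternating sign matrices are ordered by entrywise comparison of their height function
matrices. -/
noncomputable instance {n : ℕ} : PartialOrder (ASM n) :=
  PartialOrder.lift (asmEquivHFM n) (asmEquivHFM n).injective

/-- The lattice of alternating sign matrices, transported from height function matrices. -/
noncomputable instance {n : ℕ} : Lattice (ASM n) where
  sup A B := (asmEquivHFM n).symm (asmEquivHFM n A ⊔ asmEquivHFM n B)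
  inf A B := (asmEquivHFM n).symm (asmEquivHFM n A ⊓ asmEquivHFM n B)
  le_sup_left A B := by
    change asmEquivHFM n A ≤ asmEquivHFM n _
    rw [Equiv.apply_symm_apply]; exact le_sup_left
  le_sup_right A B := by
    change asmEquivHFM n B ≤ asmEquivHFM n _
    rw [Equiv.apply_symm_apply]; exact le_sup_right
  sup_le A B C h1 h2 := by
    change asmEquivHFM n _ ≤ asmEquivHFM n C
    rw [Equiv.apply_symm_apply]; exact sup_le h1 h2
  inf_le_left A B := by
    change asmEquivHFM n _ ≤ asmEquivHFM n A
    rw [Equiv.apply_symm_apply]; exact inf_le_left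
  inf_le_right A B := by
    change asmEquivHFM n _ ≤ asmEquivHFM n B
    rw [Equiv.apply_symm_apply]; exact inf_le_right
  le_inf A B C h1 h2 := by
    change asmEquivHFM n A ≤ asmEquivHFM n _
    rw [Equiv.apply_symm_apply]; exact le_inf h1 h2

/-- An alternating sign matrix is permutational if it is a permutation matrix. -/
def ASM.IsPermutational {n : ℕ} (A : ASM n) : Prop :=
  ∃ σ : Equiv.Perm (Fin n), A.mat = σ.permMatrix ℤ

/-! ### Join irreducibles, congruences and quotients of a lattice -/

section LatticeNotions

variable {L : Type*} [Lattice L]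

/-- An element is join irreducible if it covers exactly one element. -/
def IsJoinIrred (x : L) : Prop := ∃! y, y ⋖ x

/-- The set of maximal elements among the join irreducibles below `x`. -/
def joinands (x : L) : Set L := {j | Maximal (fun i => IsJoinIrred i ∧ i ≤ x) j}

/-- The join irreducibles not contracted by a congruence, that is, not congruent to the unique
element that they cover. -/
def uncontracted (c : LatticeCon L) : Set L :=
  {j | IsJoinIrred j ∧ ∀ y, y ⋖ j → ¬ c.r j y}

/-- `x` is the minimum of its congruence class. -/
def IsClassMin (c : LatticeCon L) (x : L) : Prop := IsLeast {y | c.r x y} x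

/-- The set of congruence classes. -/
def ConQuotient (c : LatticeCon L) : Type _ := Quotient c.toSetoid

/-- The class of an element. -/
def ConQuotient.mk (c : LatticeCon L) (x : L) : ConQuotient c := Quotient.mk c.toSetoid x

theorem ConQuotient.mk_eq {c : LatticeCon L} {x y : L} :
    ConQuotient.mk c x = ConQuotient.mk c y ↔ c.r x y := Quotient.eq (r := c.toSetoid)

theorem ConQuotient.exists_rep {c : LatticeCon L} (X : ConQuotient c) :
    ∃ x, ConQuotient.mk c x = X := Quotient.exists_rep X

/-- `X ≤ Y` if some representative of `X` is below some representative of `Y`. -/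
instance (c : LatticeCon L) : LE (ConQuotient c) where
  le X Y := ∃ x y, ConQuotient.mk c x = X ∧ ConQuotient.mk c y = Y ∧ x ≤ y

theorem ConQuotient.mk_le_mk {c : LatticeCon L} {x y : L} :
    ConQuotient.mk c x ≤ ConQuotient.mk c y ↔ c.r (x ⊔ y) y := by
  constructor
  · rintro ⟨x', y', hx, hy, h⟩
    rw [ConQuotient.mk_eq] at hx hy
    have h1 := c.sup (c.symm hx) (c.symm hy)
    rw [sup_eq_right.mpr h] at h1
    exact c.trans h1 hy
  · intro h
    exact ⟨x, x ⊔ y, rfl, ConQuotient.mk_eq.mpr h, le_sup_left⟩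

/-- The quotient of a lattice by a congruence. -/
instance (c : LatticeCon L) : Lattice (ConQuotient c) where
  le_refl X := by
    obtain ⟨x, rfl⟩ := X.exists_rep
    exact ⟨x, x, rfl, rfl, le_rfl⟩
  le_trans X Y Z h1 h2 := by
    obtain ⟨x, rfl⟩ := X.exists_rep
    obtain ⟨y, rfl⟩ := Y.exists_rep
    obtain ⟨z, rfl⟩ := Z.exists_rep
    rw [ConQuotient.mk_le_mk] at *
    have a1 := c.sup (c.refl x) (c.symm h2)
    have a2 := c.sup h1 (c.refl z)
    rw [sup_assoc] at a2
    exact c.trans (c.trans a1 a2) h2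
  le_antisymm X Y h1 h2 := by
    obtain ⟨x, rfl⟩ := X.exists_rep
    obtain ⟨y, rfl⟩ := Y.exists_rep
    rw [ConQuotient.mk_le_mk] at *
    rw [ConQuotient.mk_eq]
    rw [sup_comm] at h2
    exact c.trans (c.symm h2) h1
  sup := Quotient.map₂ (· ⊔ ·) fun _ _ h1 _ _ h2 => c.sup h1 h2
  inf := Quotient.map₂ (· ⊓ ·) fun _ _ h1 _ _ h2 => c.inf h1 h2
  le_sup_left X Y := by
    obtain ⟨x, rfl⟩ := X.exists_rep
    obtain ⟨y, rfl⟩ := Y.exists_rep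
    exact ⟨x, x ⊔ y, rfl, rfl, le_sup_left⟩
  le_sup_right X Y := by
    obtain ⟨x, rfl⟩ := X.exists_rep
    obtain ⟨y, rfl⟩ := Y.exists_rep
    exact ⟨y, x ⊔ y, rfl, rfl, le_sup_right⟩
  sup_le X Y Z h1 h2 := by
    obtain ⟨x, rfl⟩ := X.exists_rep
    obtain ⟨y, rfl⟩ := Y.exists_rep
    obtain ⟨z, rfl⟩ := Z.exists_rep
    change ConQuotient.mk c (x ⊔ y) ≤ _
    rw [ConQuotient.mk_le_mk] at *
    have a1 := c.sup (c.refl x) h2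
    rw [← sup_assoc] at a1
    exact c.trans a1 h1
  inf_le_left X Y := by
    obtain ⟨x, rfl⟩ := X.exists_rep
    obtain ⟨y, rfl⟩ := Y.exists_rep
    exact ⟨x ⊓ y, x, rfl, rfl, inf_le_left⟩
  inf_le_right X Y := by
    obtain ⟨x, rfl⟩ := X.exists_rep
    obtain ⟨y, rfl⟩ := Y.exists_rep
    exact ⟨x ⊓ y, y, rfl, rfl, inf_le_right⟩
  le_inf X Y Z h1 h2 := by
    obtain ⟨x, rfl⟩ := X.exists_rep
    obtain ⟨y, rfl⟩ := Y.exists_rep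
    obtain ⟨z, rfl⟩ := Z.exists_rep
    change _ ≤ ConQuotient.mk c (y ⊓ z)
    rw [ConQuotient.mk_le_mk] at h1 h2
    refine ⟨(x ⊔ y) ⊓ (x ⊔ z) ⊓ x, (x ⊔ y) ⊓ (x ⊔ z), ?_, ?_, inf_le_left⟩
    · rw [inf_eq_right.mpr (le_inf le_sup_left le_sup_left)]
    · exact ConQuotient.mk_eq.mpr (c.inf h1 h2)

end LatticeNotions

/-! ### Dyck paths and catalan congruences -/

/-- Dyck paths of semilength `n`, given by the heights of their points of abscissa
`0, 1, …, 2 * n`. -/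
@[ext]
structure DyckPath (n : ℕ) where
  height : Fin (2 * n + 1) → ℤ
  start : height 0 = 0
  finish : height (Fin.last (2 * n)) = 0
  nonneg : ∀ i, 0 ≤ height i
  step : ∀ i : Fin (2 * n), height i.succ = height i.castSucc + 1 ∨
    height i.succ = height i.castSucc - 1

/-- The Stanley order: `P ≤ Q` if `P` stays below `Q`. -/
noncomputable instance {n : ℕ} : PartialOrder (DyckPath n) :=
  PartialOrder.lift DyckPath.height fun _ _ => DyckPath.ext

/-- A congruence of the lattice of alternating sign matrices of order `n` is catalan if its quotient
is isomorphic to the Stanley lattice on Dyck paths of semilength `n`. (An order isomorphism between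
lattices preserves joins and meets.) -/
def IsCatalan {n : ℕ} (c : LatticeCon (ASM n)) : Prop :=
  Nonempty (ConQuotient c ≃o DyckPath n)

/-- The graph on the join irreducibles of the lattice of alternating sign matrices of order `n`,
where `J` and `J'` are adjacent if `J ⊔ J'` is not permutational. -/
def nonpermutationalGraph (n : ℕ) : SimpleGraph {J : ASM n // IsJoinIrred J} where
  Adj J J' := J ≠ J' ∧ ¬ (J.1 ⊔ J'.1).IsPermutational
  symm := ⟨fun _ _ h => ⟨h.1.symm, by rw [sup_comm]; exact h.2⟩⟩
  loopless := ⟨fun _ h => h.1 rfl⟩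

end AltSign

/-!
The lattice of alternating sign matrices is finite and distributive. In such a lattice an element is
the join of its canonical joinands, and it is the minimum of its class for a congruence if and only
if none of its canonical joinands is contracted (`isClassMin_iff_joinands_subset`).

In terms of height function matrices, the join irreducibles are the cones
`(k, l) ↦ max |k - l| (h - |i - k| - |j - l|)` with `|i - j| < h` (`IsJoinIrred.exists_eq_cone`), and
they are permutational. An alternating sign matrix is not permutational if and only if it has an
entry `-1`, that is, a unit square on which its height function takes the values `h + 1` at the two
diagonal corners and `h` at the two others. Each of the two diagonal values is attained by a
canonical joinand, and the join of these two joinands still has an entry `-1` at that place; they are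
distinct because their join is not permutational. This is the first assertion
(`exists_joinands_sup_not_isPermutational`), and together with the description of the minima of
classes it gives the three equivalent conditions.

For a catalan congruence, let `s` be the lower adjoint of the projection from alternating sign
matrices to Dyck paths. It is an order embedding, it preserves joins and join irreducibility, and its
values are minima of classes. The posets of join irreducibles on both sides are ranked by the apex
height, which ranges from `2` to `n`, and every join irreducible Dyck path of height `h` starts a
chain through all larger heights, so `s` does not increase the height (`apex_le_of_gc`). Hence `s`
maps the `n - 1` atoms on the Dyck side bijectively onto the `n - 1` atoms of the lattice of
alternating sign matrices, the cones of apex `(i, i, 2)`. The join of the atoms of apex `(1, 1, 2)`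
and `(2, 2, 2)` is then the minimum of its class, and it has an entry `-1`.
-/

namespace AltSign

/-! ### Join irreducibles and congruences of finite distributive lattices -/

section FiniteDistributive

theorem isJoinIrred_iff_supIrred {L : Type*} [Lattice L] [Finite L] {x : L} :
    IsJoinIrred x ↔ SupIrred x := by
  constructor
  · rintro ⟨y, hy, huniq⟩
    refine ⟨fun h => h.not_lt hy.lt, fun b c hbc => ?_⟩
    by_contra! hne
    have key : ∀ b, b ≤ x → b ≠ x → b ≤ y := by
      intro b hb hbx
      obtain ⟨z, hbz, hz⟩ := exists_le_covBy_of_lt (lt_of_le_of_ne hb hbx)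
      exact huniq z hz ▸ hbz
    have hxy : x ≤ y := hbc ▸ sup_le (key b (hbc ▸ le_sup_left) hne.1)
      (key c (hbc ▸ le_sup_right) hne.2)
    exact hy.lt.not_ge hxy
  · rintro ⟨hmin, h⟩
    obtain ⟨b, hb⟩ := not_isMin_iff.mp hmin
    obtain ⟨y, -, hy⟩ := exists_le_covBy_of_lt hb
    refine ⟨y, hy, fun z hz => ?_⟩
    by_contra hne
    have hsup : y < z ⊔ y := right_lt_sup.mpr fun hzy =>
      hz.2 (lt_of_le_of_ne hzy hne) hy.lt
    have hx : z ⊔ y = x := eq_of_le_of_not_lt (sup_le hz.le hy.le) (hy.2 hsup)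
    rcases h hx with e | e
    · exact hz.lt.ne e
    · exact hy.lt.ne e

theorem exists_isJoinIrred_le_not_le {L : Type*} [Lattice L] [Finite L] {x y : L} (h : ¬ x ≤ y) :
    ∃ j, IsJoinIrred j ∧ j ≤ x ∧ ¬ j ≤ y := by
  obtain ⟨z, -, hz⟩ := Finite.exists_le_minimal (p := fun z => z ≤ x ∧ ¬ z ≤ y) ⟨le_rfl, h⟩
  refine ⟨z, isJoinIrred_iff_supIrred.mpr ⟨fun hmin => ?_, fun b c hbc => ?_⟩, hz.prop⟩
  · exact hz.prop.2 ((hmin inf_le_left).trans inf_le_right : z ≤ y)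
  · by_contra! hne
    have key : ∀ b, b ≤ z → b ≠ z → b ≤ y := by
      intro b hb hbz
      by_contra hby
      exact hbz (le_antisymm hb (hz.2 ⟨hb.trans hz.prop.1, hby⟩ hb))
    exact hz.prop.2 (hbc ▸ sup_le (key b (hbc ▸ le_sup_left) hne.1)
      (key c (hbc ▸ le_sup_right) hne.2))

theorem exists_mem_joinands_ge {L : Type*} [Lattice L] [Finite L] {x j : L} (hj : IsJoinIrred j)
    (hjx : j ≤ x) : ∃ i ∈ joinands x, j ≤ i := by
  obtain ⟨i, hji, hi⟩ := Finite.exists_le_maximal (p := fun i => IsJoinIrred i ∧ i ≤ x) ⟨hj, hjx⟩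
  exact ⟨i, hi, hji⟩

theorem le_of_forall_mem_joinands_le {L : Type*} [Lattice L] [Finite L] {x y : L}
    (h : ∀ j ∈ joinands x, j ≤ y) : x ≤ y := by
  by_contra hxy
  obtain ⟨j, hj, hjx, hjy⟩ := exists_isJoinIrred_le_not_le hxy
  obtain ⟨i, hi, hji⟩ := exists_mem_joinands_ge hj hjx
  exact hjy (hji.trans (h i hi))

theorem eq_sup_of_joinands_eq_pair {L : Type*} [Lattice L] [Finite L] {x j k : L}
    (h : joinands x = {j, k}) : x = j ⊔ k := by
  have hj : j ∈ joinands x := h ▸ Set.mem_insert j {k}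
  have hk : k ∈ joinands x := h ▸ Set.mem_insert_of_mem j rfl
  refine le_antisymm (le_of_forall_mem_joinands_le fun i hi => ?_) (sup_le hj.1.2 hk.1.2)
  rw [h] at hi
  rcases hi with rfl | rfl
  · exact le_sup_left
  · exact le_sup_right

variable {L : Type*} [DistribLattice L] [Finite L]

theorem IsJoinIrred.le_sup {j a b : L} (hj : IsJoinIrred j) (h : j ≤ a ⊔ b) : j ≤ a ∨ j ≤ b :=
  (isJoinIrred_iff_supIrred.mp hj).supPrime.2 h

theorem joinands_sup_eq_pair {j k : L} (hj : IsJoinIrred j) (hk : IsJoinIrred k) (hjk : ¬ j ≤ k)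
    (hkj : ¬ k ≤ j) : joinands (j ⊔ k) = {j, k} := by
  have hmax : ∀ j k : L, IsJoinIrred j → ¬ j ≤ k → j ∈ joinands (j ⊔ k) := by
    refine fun j k hj hjk => ⟨⟨hj, le_sup_left⟩, fun i hi hji => ?_⟩
    exact (hi.1.le_sup hi.2).resolve_right fun hik => hjk (hji.trans hik)
  ext i
  constructor
  · intro hi
    rcases hi.1.1.le_sup hi.1.2 with h | h
    · exact Or.inl (le_antisymm h (hi.2 ⟨hj, le_sup_left⟩ h))
    · exact Or.inr (le_antisymm h (hi.2 ⟨hk, le_sup_right⟩ h))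
  · rintro (rfl | rfl)
    · exact hmax _ _ hj hjk
    · rw [sup_comm]
      exact hmax _ _ hk hkj

/-- The minima of the congruence classes are the elements whose canonical join representation
contains no contracted join irreducible. -/
theorem isClassMin_iff_joinands_subset (c : LatticeCon L) {x : L} :
    IsClassMin c x ↔ joinands x ⊆ uncontracted c := by
  constructor
  · intro hx j hj
    refine ⟨hj.1.1, fun y hy hjy => ?_⟩
    -- If `j` were congruent to `y ⋖ j`, then a maximal element `w` of the set of those elements
    -- between `y` and `x` that do not lie above `j` would be congruent to `w ⊔ j = x`.
    obtain ⟨w, hyw, hw⟩ := Finite.exists_le_maximal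
      (p := fun z => z ≤ x ∧ ¬ j ≤ z) ⟨hy.le.trans hj.1.2, hy.lt.not_ge⟩
    have hxw : x ≤ w ⊔ j := by
      by_contra hcon
      obtain ⟨i, hi, hix, hiw⟩ := exists_isJoinIrred_le_not_le hcon
      have hjwi : j ≤ w ⊔ i := by
        by_contra hji
        exact hiw ((le_sup_right.trans (hw.2 ⟨sup_le hw.prop.1 hix, hji⟩ le_sup_left)).trans
          le_sup_left)
      have hji := (hj.1.1.le_sup hjwi).resolve_left hw.prop.2
      exact hiw ((hj.2 ⟨hi, hix⟩ hji).trans le_sup_right)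
    have hrel : c.r x w := by
      have := c.sup (c.refl w) hjy
      rwa [sup_eq_left.mpr hyw, le_antisymm (sup_le hw.prop.1 hj.1.2) hxw] at this
    exact hw.prop.2 (hj.1.2.trans (hx.2 hrel))
  · refine fun h => ⟨c.refl x, fun y hxy => le_of_forall_mem_joinands_le fun j hj => ?_⟩
    by_contra hjy
    obtain ⟨hirr, hunc⟩ := h hj
    obtain ⟨z, hz, huniq⟩ := hirr
    obtain ⟨z', hz', hzc⟩ := exists_le_covBy_of_lt (inf_lt_left.mpr hjy)
    have hrel : c.r j (j ⊓ y) := by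
      have := c.inf (c.refl j) hxy
      rwa [inf_eq_left.mpr hj.1.2] at this
    refine hunc z' hzc ?_
    have := c.sup (c.refl z') hrel
    rwa [sup_eq_right.mpr hzc.le, sup_eq_left.mpr hz'] at this

end FiniteDistributive

/-! ### Height functions of alternating sign matrices -/

theorem IsAlternating.exists_eq_one {n : ℕ} {a : Fin n → ℤ} (h : IsAlternating a)
    (h0 : ∀ i, 0 ≤ a i) : ∃ i, ∀ k, a k = if i = k then 1 else 0 := by
  obtain ⟨i, hi⟩ : ∃ i, a i ≠ 0 := by
    by_contra! hz
    have := h.sum_eq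
    simp [hz] at this
  refine ⟨i, fun k => ?_⟩
  have hone : a i = 1 := by
    have := h.entry i; have := h0 i; omega
  split_ifs with hik
  · rw [← hik, hone]
  · have hle := Finset.sum_le_sum_of_subset_of_nonneg (Finset.subset_univ {i, k})
      fun l _ _ => h0 l
    rw [Finset.sum_pair hik, h.sum_eq] at hle
    have := h0 k
    omega

/-- A nonnegative alternating sequence is an indicator of one index, so an alternating sign matrix
without an entry `-1` is a permutation matrix. -/
theorem ASM.isPermutational_iff_nonneg {n : ℕ} {A : ASM n} :
    A.IsPermutational ↔ ∀ i j, 0 ≤ A.mat i j := by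
  constructor
  · rintro ⟨σ, hσ⟩ i j
    rw [hσ, Equiv.Perm.permMatrix, PEquiv.toMatrix_apply]
    split_ifs <;> norm_num
  · intro h
    choose f hf using fun i => (A.row i).exists_eq_one (h i)
    choose g hg using fun j => (A.col j).exists_eq_one fun i => h i j
    have hinj : Function.Injective f := by
      intro i k hik
      have h1 : A.mat i (f i) = 1 := by simp [hf]
      have h2 : A.mat k (f i) = 1 := by simp [hf, hik]
      simp only [hg] at h1 h2
      by_contra hne
      grind
    refine ⟨Equiv.ofBijective f (Finite.injective_iff_bijective.mp hinj), ?_⟩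
    ext i j
    rw [hf, Equiv.Perm.permMatrix, PEquiv.toMatrix_apply]
    simp [eq_comm]

theorem ASM.two_mul_mat {n : ℕ} (A : ASM n) (i j : Fin n) :
    2 * A.mat i j = A.toHFM.val i.castSucc j.succ + A.toHFM.val i.succ j.castSucc
      - A.toHFM.val i.castSucc j.castSucc - A.toHFM.val i.succ j.succ := by
  rw [← HFM.two_mul_toMatrix]
  exact congrArg (fun B : ASM n => 2 * B.mat i j) ((asmEquivHFM n).left_inv A).symm

theorem ASM.sup_val {n : ℕ} (A B : ASM n) (i j : Fin (n + 1)) :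
    (A ⊔ B).toHFM.val i j = max (A.toHFM.val i j) (B.toHFM.val i j) :=
  congrArg (fun H : HFM n => H.val i j) ((asmEquivHFM n).right_inv (A.toHFM ⊔ B.toHFM))

theorem ASM.inf_val {n : ℕ} (A B : ASM n) (i j : Fin (n + 1)) :
    (A ⊓ B).toHFM.val i j = min (A.toHFM.val i j) (B.toHFM.val i j) :=
  congrArg (fun H : HFM n => H.val i j) ((asmEquivHFM n).right_inv (A.toHFM ⊓ B.toHFM))

theorem ASM.le_iff_val {n : ℕ} {A B : ASM n} :
    A ≤ B ↔ ∀ i j, A.toHFM.val i j ≤ B.toHFM.val i j := Iff.rfl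

noncomputable instance {n : ℕ} : DistribLattice (ASM n) where
  le_sup_inf A B C := by
    rw [ASM.le_iff_val]
    intro i j
    simp only [ASM.sup_val, ASM.inf_val]
    omega

instance {n : ℕ} : Finite (ASM n) := by
  refine Finite.of_injective
    (fun A : ASM n => fun i j => (⟨A.mat i j, ?_⟩ : Set.Icc (-1 : ℤ) 1)) fun A B h => ?_
  · have := (A.row i).entry j
    simp only [Set.mem_Icc]
    omega
  · ext i j
    exact congrArg Subtype.val (congrFun (congrFun h i) j)

/-- A sequence with steps `±1` is `1`-Lipschitz. -/
theorem apply_le_apply_add_abs {n : ℕ} {f : Fin (n + 1) → ℤ}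
    (h : ∀ i : Fin n, |f i.succ - f i.castSucc| = 1) (i j : Fin (n + 1)) :
    f i ≤ f j + |(i : ℤ) - j| := by
  have key : ∀ d : ℕ, ∀ i j : Fin (n + 1), (i : ℕ) + d = j → |f i - f j| ≤ d := by
    intro d
    induction d with
    | zero =>
      intro i j hij
      obtain rfl : i = j := Fin.ext hij
      simp
    | succ d ih =>
      intro i j hij
      let k : Fin n := ⟨i + d, by omega⟩
      have h1 := ih i k.castSucc rfl
      have h2 := h k
      rw [show k.succ = j from Fin.ext (by simp [k]; omega)] at h2
      push_cast
      rw [abs_le] at *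
      rw [abs_eq (by norm_num)] at h2
      omega
  rcases le_total (i : ℕ) j with hij | hij
  · have := key (j - i) i j (by omega)
    rw [abs_le] at this
    rw [abs_of_nonpos (by omega)]
    omega
  · have := key (i - j) j i (by omega)
    rw [abs_le] at this
    rw [abs_of_nonneg (by omega)]
    omega

theorem HFM.val_le_add_dist {n : ℕ} (H : HFM n) (i j k l : Fin (n + 1)) :
    H.val i j ≤ H.val k l + |(i : ℤ) - k| + |(j : ℤ) - l| := by
  have h1 := apply_le_apply_add_abs (H.row_step i) j l
  have h2 := apply_le_apply_add_abs (f := fun i => H.val i l) (fun k => H.col_step k l) i k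
  omega

theorem HFM.abs_sub_le_val {n : ℕ} (H : HFM n) (i j : Fin (n + 1)) :
    |(i : ℤ) - j| ≤ H.val i j := by
  have h1 := H.val_le_add_dist 0 j i j
  have h2 := H.val_le_add_dist i 0 i j
  simp only [H.first_row, H.first_col, Fin.val_zero, Nat.cast_zero, zero_sub, abs_neg, Nat.abs_cast,
    sub_self, abs_zero, add_zero] at h1 h2
  exact abs_le.mpr ⟨by omega, by omega⟩

theorem HFM.val_le_add {n : ℕ} (H : HFM n) (i j : Fin (n + 1)) : H.val i j ≤ i + j := by
  have h1 := H.val_le_add_dist i j 0 j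
  simp only [H.first_row, Fin.val_zero, Nat.cast_zero, sub_zero, Nat.abs_cast, sub_self,
    abs_zero, add_zero] at h1
  omega

theorem HFM.val_le_sub {n : ℕ} (H : HFM n) (i j : Fin (n + 1)) : H.val i j ≤ 2 * n - i - j := by
  have h1 := H.val_le_add_dist i j (Fin.last n) j
  simp only [H.last_row, Fin.val_last] at h1
  grind

/-! ### Join irreducible alternating sign matrices -/

/-- The triples `(i, j, h)` such that some height function matrix takes the value `h` at `(i, j)`. -/
structure IsApex {n : ℕ} (i j : Fin (n + 1)) (h : ℤ) : Prop where
  abs_le : |(i : ℤ) - j| ≤ h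
  le_add : h ≤ i + j
  le_sub : h ≤ 2 * n - i - j
  parity : h % 2 = ((i : ℤ) + j) % 2

theorem HFM.isApex {n : ℕ} (H : HFM n) (i j : Fin (n + 1)) : IsApex i j (H.val i j) :=
  ⟨H.abs_sub_le_val i j, H.val_le_add i j, H.val_le_sub i j, H.parity i j⟩

/-- The least height function matrix whose value at `(i, j)` is at least `h`: the maximum of the
least height function matrix `|k - l|` and of a cone of apex `(i, j, h)`. -/
def coneHFM {n : ℕ} {i j : Fin (n + 1)} {h : ℤ} (H : IsApex i j h) : HFM n where
  val k l := max |(k : ℤ) - l| (h - |(i : ℤ) - k| - |(j : ℤ) - l|)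
  first_row l := by have := H.le_add; simp only [Fin.val_zero]; grind
  first_col k := by have := H.le_add; simp only [Fin.val_zero]; grind
  last_row l := by have := H.le_sub; simp only [Fin.val_last]; grind
  last_col k := by have := H.le_sub; simp only [Fin.val_last]; grind
  row_step k l := by
    have := H.parity
    simp only [Fin.val_succ, Fin.val_castSucc, Nat.cast_add, Nat.cast_one]
    rw [abs_eq (by norm_num)]
    grind
  col_step k l := by
    have := H.parity
    simp only [Fin.val_succ, Fin.val_castSucc, Nat.cast_add, Nat.cast_one]
    rw [abs_eq (by norm_num)]
    grind

/-- The alternating sign matrix with height function matrix `coneHFM H`. -/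
def cone {n : ℕ} {i j : Fin (n + 1)} {h : ℤ} (H : IsApex i j h) : ASM n := (coneHFM H).toASM

theorem cone_val {n : ℕ} {i j : Fin (n + 1)} {h : ℤ} (H : IsApex i j h) (k l : Fin (n + 1)) :
    (cone H).toHFM.val k l = max |(k : ℤ) - l| (h - |(i : ℤ) - k| - |(j : ℤ) - l|) :=
  congrArg (fun H : HFM n => H.val k l) ((asmEquivHFM n).right_inv (coneHFM H))

theorem cone_val_apex {n : ℕ} {i j : Fin (n + 1)} {h : ℤ} (H : IsApex i j h) :
    (cone H).toHFM.val i j = h := by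
  have := H.abs_le
  simp only [cone_val, sub_self, abs_zero]
  omega

theorem cone_le_iff {n : ℕ} {i j : Fin (n + 1)} {h : ℤ} (H : IsApex i j h) {A : ASM n} :
    cone H ≤ A ↔ h ≤ A.toHFM.val i j := by
  constructor
  · intro hA
    have := ASM.le_iff_val.mp hA i j
    rwa [cone_val_apex] at this
  · intro hA
    rw [ASM.le_iff_val]
    intro k l
    rw [cone_val]
    have h1 := A.toHFM.val_le_add_dist i j k l
    have h2 := A.toHFM.abs_sub_le_val k l
    omega

theorem isJoinIrred_cone {n : ℕ} {i j : Fin (n + 1)} {h : ℤ} (H : IsApex i j h)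
    (hlt : |(i : ℤ) - j| < h) : IsJoinIrred (cone H) := by
  refine isJoinIrred_iff_supIrred.mpr ⟨fun hmin => ?_, fun A B hAB => ?_⟩
  · -- The cone of apex `(0, 0, 0)` is the least element.
    have H0 : IsApex (0 : Fin (n + 1)) 0 0 := by constructor <;> simp
    have hle := (cone_le_iff H).mp (hmin ((cone_le_iff H0).mpr (by simp [HFM.first_row])))
    rw [cone_val] at hle
    simp only [Fin.val_zero] at hle
    grind
  · have hval := ASM.sup_val A B i j
    rw [hAB, cone_val_apex] at hval
    rcases max_choice (A.toHFM.val i j) (B.toHFM.val i j) with e | e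
    · exact Or.inl (le_antisymm (hAB ▸ le_sup_left) ((cone_le_iff H).mpr (by omega)))
    · exact Or.inr (le_antisymm (hAB ▸ le_sup_right) ((cone_le_iff H).mpr (by omega)))

/-- If `B ⋖ A` and `A` exceeds `B` at `(i, j)`, then the cone below `A` of apex `(i, j)` is not below
`B`; as `A` is join prime, it equals this cone. -/
theorem IsJoinIrred.exists_eq_cone {n : ℕ} {A : ASM n} (hA : IsJoinIrred A) :
    ∃ i j h, ∃ H : IsApex i j h, |(i : ℤ) - j| < h ∧ A = cone H := by
  obtain ⟨B, hB, -⟩ := id hA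
  obtain ⟨i, j, hij⟩ : ∃ i j, B.toHFM.val i j < A.toHFM.val i j := by
    by_contra! hcon
    exact hB.lt.not_ge (ASM.le_iff_val.mpr hcon)
  have H := A.toHFM.isApex i j
  have hle : cone H ≤ A := (cone_le_iff H).mpr le_rfl
  refine ⟨i, j, _, H, (B.toHFM.abs_sub_le_val i j).trans_lt hij, ?_⟩
  have hsup : A ≤ B ⊔ cone H := by
    refine (eq_of_le_of_not_lt (sup_le hB.le hle) (hB.2 (left_lt_sup.mpr fun h => ?_))).ge
    exact hij.not_ge ((cone_le_iff H).mp h)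
  exact le_antisymm ((hA.le_sup hsup).resolve_left hB.lt.not_ge) hle

theorem IsJoinIrred.isPermutational {n : ℕ} {A : ASM n} (hA : IsJoinIrred A) :
    A.IsPermutational := by
  obtain ⟨i, j, h, H, -, rfl⟩ := hA.exists_eq_cone
  rw [ASM.isPermutational_iff_nonneg]
  intro k l
  have hm := (cone H).two_mul_mat k l
  simp only [cone_val, Fin.val_succ, Fin.val_castSucc, Nat.cast_add, Nat.cast_one] at hm
  have := H.parity
  grind

theorem exists_mem_joinands_val_eq {n : ℕ} {A : ASM n} {i j : Fin (n + 1)}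
    (h : |(i : ℤ) - j| < A.toHFM.val i j) :
    ∃ J ∈ joinands A, J.toHFM.val i j = A.toHFM.val i j := by
  have H := A.toHFM.isApex i j
  obtain ⟨J, hJ, hle⟩ := exists_mem_joinands_ge (isJoinIrred_cone H h)
    ((cone_le_iff H).mpr le_rfl)
  exact ⟨J, hJ, le_antisymm (ASM.le_iff_val.mp hJ.1.2 i j) ((cone_le_iff H).mp hle)⟩

/-- Around an entry `-1` the height function matrix takes the values `h + 1` on the diagonal and `h`
on the antidiagonal. Canonical joinands that attain the two values `h + 1` already have a join with
an entry `-1` at the same place. -/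
theorem exists_joinands_sup_not_isPermutational {n : ℕ} {A : ASM n} (hA : ¬ A.IsPermutational) :
    ∃ J ∈ joinands A, ∃ K ∈ joinands A, ¬ (J ⊔ K).IsPermutational := by
  rw [ASM.isPermutational_iff_nonneg] at hA
  push Not at hA
  obtain ⟨i, j, hij⟩ := hA
  have hm := A.two_mul_mat i j
  have hentry := (A.row i).entry j
  have r1 := A.toHFM.row_step i.castSucc j
  have r2 := A.toHFM.row_step i.succ j
  have c1 := A.toHFM.col_step i j.castSucc
  have c2 := A.toHFM.col_step i j.succ
  rw [abs_eq (by norm_num)] at r1 r2 c1 c2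
  have b1 := A.toHFM.abs_sub_le_val i.castSucc j.succ
  have b2 := A.toHFM.abs_sub_le_val i.succ j.castSucc
  obtain ⟨J, hJ, hJv⟩ := exists_mem_joinands_val_eq (A := A) (i := i.castSucc) (j := j.castSucc) (by
    simp only [Fin.val_succ, Fin.val_castSucc, Nat.cast_add, Nat.cast_one] at *
    grind)
  obtain ⟨K, hK, hKv⟩ := exists_mem_joinands_val_eq (A := A) (i := i.succ) (j := j.succ) (by
    simp only [Fin.val_succ, Fin.val_castSucc, Nat.cast_add, Nat.cast_one] at *
    grind)
  refine ⟨J, hJ, K, hK, fun hp => ?_⟩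
  have hle := ASM.le_iff_val.mp (sup_le hJ.1.2 hK.1.2)
  have h1 := hle i.castSucc j.succ
  have h2 := hle i.succ j.castSucc
  have h3 := ASM.sup_val J K i.castSucc j.castSucc
  have h4 := ASM.sup_val J K i.succ j.succ
  have h5 := (J ⊔ K).two_mul_mat i j
  have h6 := ASM.isPermutational_iff_nonneg.mp hp i j
  omega

theorem joinands_sup_of_not_isPermutational {n : ℕ} {J K : ASM n} (hJ : IsJoinIrred J)
    (hK : IsJoinIrred K) (h : ¬ (J ⊔ K).IsPermutational) :
    joinands (J ⊔ K) = {J, K} ∧ J ≠ K := by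
  have h1 : ¬ J ≤ K := fun hle => h (by rw [sup_eq_right.mpr hle]; exact hK.isPermutational)
  have h2 : ¬ K ≤ J := fun hle => h (by rw [sup_eq_left.mpr hle]; exact hJ.isPermutational)
  exact ⟨joinands_sup_eq_pair hJ hK h1 h2, fun he => h1 he.le⟩

theorem exists_joinands_subset_ncard_eq_two {n : ℕ} {A : ASM n} (hA : ¬ A.IsPermutational) :
    ∃ A' : ASM n, ¬ A'.IsPermutational ∧ (joinands A').ncard = 2 ∧ joinands A' ⊆ joinands A := by
  obtain ⟨J, hJ, K, hK, h⟩ := exists_joinands_sup_not_isPermutational hA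
  obtain ⟨hpair, hne⟩ := joinands_sup_of_not_isPermutational hJ.1.1 hK.1.1 h
  refine ⟨J ⊔ K, h, by rw [hpair, Set.ncard_pair hne], ?_⟩
  rw [hpair]
  exact Set.pair_subset hJ hK

theorem tfae_forall_isClassMin_isPermutational {n : ℕ} (c : LatticeCon (ASM n)) : List.TFAE [
    ∀ A : ASM n, IsClassMin c A → A.IsPermutational,
    ∀ A : ASM n, ¬ A.IsPermutational → (joinands A).ncard = 2 → ¬ joinands A ⊆ uncontracted c,
    (nonpermutationalGraph n).IsVertexCover {J | J.1 ∉ uncontracted c}] := by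
  tfae_have 1 → 2 := fun h A hA _ hsub => hA (h A ((isClassMin_iff_joinands_subset c).mpr hsub))
  tfae_have 2 → 1 := by
    intro h A hmin
    by_contra hA
    obtain ⟨A', hA', hcard, hsub⟩ := exists_joinands_subset_ncard_eq_two hA
    exact h A' hA' hcard (hsub.trans ((isClassMin_iff_joinands_subset c).mp hmin))
  tfae_have 2 → 3 := by
    intro h J K hJK
    obtain ⟨hpair, hne⟩ := joinands_sup_of_not_isPermutational J.2 K.2 hJK.2
    have := h _ hJK.2 (by rw [hpair, Set.ncard_pair hne])
    rw [hpair, Set.pair_subset_iff, not_and_or] at this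
    exact this
  tfae_have 3 → 2 := by
    intro h A hA hcard hsub
    obtain ⟨J, K, hne, hpair⟩ := Set.ncard_eq_two.mp hcard
    have hJ : J ∈ joinands A := hpair ▸ Set.mem_insert J {K}
    have hK : K ∈ joinands A := hpair ▸ Set.mem_insert_of_mem J rfl
    have hadj : (nonpermutationalGraph n).Adj ⟨J, hJ.1.1⟩ ⟨K, hK.1.1⟩ :=
      ⟨fun he => hne (congrArg Subtype.val he), by rwa [← eq_sup_of_joinands_eq_pair hpair]⟩
    rcases h hadj with hc | hc
    · exact hc (hsub hJ)
    · exact hc (hsub hK)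
  tfae_finish

/-! ### Join irreducible Dyck paths -/

theorem DyckPath.le_iff_height {n : ℕ} {P Q : DyckPath n} :
    P ≤ Q ↔ ∀ x, P.height x ≤ Q.height x := Iff.rfl

theorem DyckPath.parity {n : ℕ} (P : DyckPath n) (x : Fin (2 * n + 1)) :
    P.height x % 2 = (x : ℤ) % 2 := by
  induction x using Fin.induction with
  | zero => simp [P.start]
  | succ x ih =>
    have := P.step x
    simp only [Fin.val_succ, Fin.val_castSucc, Nat.cast_add, Nat.cast_one] at *
    omega

theorem DyckPath.height_le_add_dist {n : ℕ} (P : DyckPath n) (x y : Fin (2 * n + 1)) :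
    P.height x ≤ P.height y + |(x : ℤ) - y| := by
  refine apply_le_apply_add_abs (fun i => ?_) x y
  rw [abs_eq (by norm_num)]
  have := P.step i
  omega

theorem DyckPath.exists_height_eq_max {n : ℕ} (P Q : DyckPath n) :
    ∃ R : DyckPath n, ∀ x, R.height x = max (P.height x) (Q.height x) := by
  refine ⟨⟨fun x => max (P.height x) (Q.height x), ?_, ?_, fun x => ?_, fun x => ?_⟩,
    fun x => rfl⟩
  · simp [P.start, Q.start]
  · simp [P.finish, Q.finish]
  · exact le_max_of_le_left (P.nonneg x)
  · have h1 := P.step x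
    have h2 := Q.step x
    have h3 := P.parity x.castSucc
    have h4 := Q.parity x.castSucc
    omega

/-- Pairs `(x, h)` such that some Dyck path passes through height `h` at abscissa `x`. -/
structure IsPeak {n : ℕ} (x : Fin (2 * n + 1)) (h : ℤ) : Prop where
  nonneg : 0 ≤ h
  le_left : h ≤ x
  le_right : h ≤ 2 * n - x
  parity : h % 2 = (x : ℤ) % 2

/-- The least Dyck path whose height at abscissa `x` is at least `h`: the maximum of the least Dyck
path and of a peak at `(x, h)`. -/
def peakPath {n : ℕ} {x : Fin (2 * n + 1)} {h : ℤ} (H : IsPeak x h) : DyckPath n where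
  height y := max ((y : ℤ) % 2) (h - |(x : ℤ) - y|)
  start := by
    have := H.le_left
    simp only [Fin.val_zero, Nat.cast_zero, sub_zero, Nat.abs_cast]
    omega
  finish := by
    have := H.le_right
    simp only [Fin.val_last, Nat.cast_mul, Nat.cast_ofNat]
    grind
  nonneg y := le_max_of_le_left (by omega)
  step y := by
    have := H.parity
    simp only [Fin.val_succ, Fin.val_castSucc, Nat.cast_add, Nat.cast_one]
    grind

theorem peakPath_height {n : ℕ} {x : Fin (2 * n + 1)} {h : ℤ} (H : IsPeak x h)
    (y : Fin (2 * n + 1)) : (peakPath H).height y = max ((y : ℤ) % 2) (h - |(x : ℤ) - y|) := rfl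

theorem peakPath_height_peak {n : ℕ} {x : Fin (2 * n + 1)} {h : ℤ} (H : IsPeak x h) :
    (peakPath H).height x = h := by
  have h1 := H.nonneg
  have h2 := H.parity
  simp only [peakPath_height, sub_self, abs_zero]
  omega

theorem peakPath_le_iff {n : ℕ} {x : Fin (2 * n + 1)} {h : ℤ} (H : IsPeak x h) {P : DyckPath n} :
    peakPath H ≤ P ↔ h ≤ P.height x := by
  constructor
  · intro hP
    have := DyckPath.le_iff_height.mp hP x
    rwa [peakPath_height_peak] at this
  · intro hP
    rw [DyckPath.le_iff_height]
    intro y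
    rw [peakPath_height]
    have h1 := P.height_le_add_dist x y
    have h2 := P.parity y
    have h3 := P.nonneg y
    omega

/-! ### Catalan congruences -/

/-- The projection onto the quotient, followed by an isomorphism onto a poset `P`, has a lower
adjoint `s`: `s p` is the least element whose class is sent above `p`. -/
theorem exists_gc_of_quotient_iso {L P : Type*} [Lattice L] [Finite L] [PartialOrder P]
    {c : LatticeCon L} (e : ConQuotient c ≃o P) :
    ∃ s : P → L, ∀ p x, s p ≤ x ↔ p ≤ e (ConQuotient.mk c x) := by
  have key : ∀ p, ∃ y, ∀ x, y ≤ x ↔ p ≤ e (ConQuotient.mk c x) := by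
    intro p
    obtain ⟨x₀, hx₀⟩ := (e.symm p).exists_rep
    obtain ⟨y, -, hy⟩ := Finite.exists_le_minimal (p := fun x => p ≤ e (ConQuotient.mk c x))
      (show p ≤ e (ConQuotient.mk c x₀) by rw [hx₀, e.apply_symm_apply])
    refine ⟨y, fun x => ⟨fun hyx => hy.prop.trans (e.monotone ⟨y, x, rfl, rfl, hyx⟩), fun hx => ?_⟩⟩
    have hinf : p ≤ e (ConQuotient.mk c (y ⊓ x)) := by
      rw [← e.symm_apply_le]
      change e.symm p ≤ ConQuotient.mk c y ⊓ ConQuotient.mk c x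
      exact le_inf (e.symm_apply_le.mpr hy.prop) (e.symm_apply_le.mpr hx)
    exact (hy.2 hinf inf_le_left).trans inf_le_right
  choose s hs using key
  exact ⟨s, hs⟩

/-- Since the projection is surjective, its lower adjoint is an order embedding. -/
theorem le_iff_of_gc {L P : Type*} [Lattice L] [PartialOrder P] {c : LatticeCon L}
    {e : ConQuotient c ≃o P} {s : P → L} (hs : ∀ p x, s p ≤ x ↔ p ≤ e (ConQuotient.mk c x))
    {p q : P} : s p ≤ s q ↔ p ≤ q := by
  have hq : e (ConQuotient.mk c (s q)) = q := by
    refine le_antisymm ?_ ((hs _ _).mp le_rfl)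
    obtain ⟨x, hx⟩ := (e.symm q).exists_rep
    have hx' : e (ConQuotient.mk c x) = q := by rw [hx, e.apply_symm_apply]
    have := e.monotone (show ConQuotient.mk c (s q) ≤ ConQuotient.mk c x from
      ⟨s q, x, rfl, rfl, (hs _ _).mpr hx'.ge⟩)
    rwa [hx'] at this
  rw [hs, hq]

/-- The lower adjoint preserves joins and takes its values in the set of minima of classes. -/
theorem isClassMin_sup_of_gc {L P : Type*} [Lattice L] [PartialOrder P] {c : LatticeCon L}
    {e : ConQuotient c ≃o P} {s : P → L} (hs : ∀ p x, s p ≤ x ↔ p ≤ e (ConQuotient.mk c x))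
    (p q : P) : IsClassMin c (s p ⊔ s q) := by
  refine ⟨c.refl _, fun y hy => ?_⟩
  have key : ∀ r, s r ≤ s p ⊔ s q → s r ≤ y := by
    intro r hr
    rw [hs] at hr ⊢
    rwa [← ConQuotient.mk_eq.mpr hy]
  exact sup_le (key p le_sup_left) (key q le_sup_right)

section LowerAdjoint

variable {n : ℕ} {c : LatticeCon (ASM n)} {e : ConQuotient c ≃o DyckPath n}
  {s : DyckPath n → ASM n}

/-- Paths with a peak of height at least `2` are join prime, and the lower adjoint carries them to join irreducibles. -/
theorem isJoinIrred_peakPath_of_gc (hs : ∀ p x, s p ≤ x ↔ p ≤ e (ConQuotient.mk c x))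
    {x : Fin (2 * n + 1)} {h : ℤ} (H : IsPeak x h) (h2 : 2 ≤ h) : IsJoinIrred (s (peakPath H)) := by
  refine isJoinIrred_iff_supIrred.mpr ⟨fun hmin => ?_, fun A B hAB => ?_⟩
  · -- The path with a peak of height `0` at abscissa `0` is the least Dyck path.
    have H0 : IsPeak (0 : Fin (2 * n + 1)) 0 := by constructor <;> simp
    have hle := (le_iff_of_gc hs).mp (hmin ((le_iff_of_gc hs).mpr
      ((peakPath_le_iff H0).mpr ((peakPath H).nonneg 0))))
    rw [peakPath_le_iff, peakPath_height] at hle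
    simp only [Fin.val_zero, Nat.cast_zero, zero_sub, abs_neg, Nat.abs_cast] at hle
    omega
  · have hle : peakPath H ≤ e (ConQuotient.mk c A ⊔ ConQuotient.mk c B) :=
      (hs _ _).mp hAB.ge
    obtain ⟨R, hR⟩ := DyckPath.exists_height_eq_max (e (ConQuotient.mk c A))
      (e (ConQuotient.mk c B))
    have hRle : e (ConQuotient.mk c A ⊔ ConQuotient.mk c B) ≤ R := by
      rw [← e.le_symm_apply]
      refine sup_le ?_ ?_ <;> rw [e.le_symm_apply, DyckPath.le_iff_height] <;> intro y <;> rw [hR]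
      · exact le_max_left _ _
      · exact le_max_right _ _
    have hmax := (peakPath_le_iff H).mp (hle.trans hRle)
    rw [hR] at hmax
    rcases le_max_iff.mp hmax with hh | hh
    · exact Or.inl (le_antisymm (hAB ▸ le_sup_left)
        ((hs _ _).mpr ((peakPath_le_iff H).mpr hh)))
    · exact Or.inr (le_antisymm (hAB ▸ le_sup_right)
        ((hs _ _).mpr ((peakPath_le_iff H).mpr hh)))

/-- A join irreducible Dyck path with a peak of height `h` starts a chain of such paths whose heights
are `h, h + 1, …, n`. The lower adjoint is strictly increasing on this chain, the apex height of a
cone increases strictly with the cone, and it is at most `n`; so `s` does not increase heights. -/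
theorem apex_le_of_gc (hs : ∀ p x, s p ≤ x ↔ p ≤ e (ConQuotient.mk c x)) (d : ℕ) :
    ∀ {x : Fin (2 * n + 1)} {h : ℤ} (H : IsPeak x h), 2 ≤ h → h + d = n →
    ∀ {i j : Fin (n + 1)} {g : ℤ} (G : IsApex i j g), |(i : ℤ) - j| < g →
    s (peakPath H) = cone G → g ≤ h := by
  induction d with
  | zero =>
    intro x h H _ hd i j g G _ _
    have := G.le_add
    have := G.le_sub
    omega
  | succ d ih =>
    intro x h H h2 hd i j g G hlt hG
    -- The apex `(x, h)` is moved one step towards `(n, n)`.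
    obtain ⟨y, H', hxy⟩ : ∃ y : Fin (2 * n + 1), ∃ _ : IsPeak y (h + 1), |(y : ℤ) - x| = 1 := by
      have h3 := H.le_left
      have h4 := H.le_right
      have h5 := H.parity
      rcases lt_or_ge (x : ℕ) n with hx | hx
      · refine ⟨⟨x + 1, by omega⟩, ⟨by omega, show h + 1 ≤ ((x + 1 : ℕ) : ℤ) by omega,
          show h + 1 ≤ 2 * n - ((x + 1 : ℕ) : ℤ) by omega,
          show (h + 1) % 2 = ((x + 1 : ℕ) : ℤ) % 2 by omega⟩,
          show |((x + 1 : ℕ) : ℤ) - x| = 1 from (abs_eq (by norm_num)).mpr (by omega)⟩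
      · refine ⟨⟨x - 1, by omega⟩, ⟨by omega, show h + 1 ≤ ((x - 1 : ℕ) : ℤ) by omega,
          show h + 1 ≤ 2 * n - ((x - 1 : ℕ) : ℤ) by omega,
          show (h + 1) % 2 = ((x - 1 : ℕ) : ℤ) % 2 by omega⟩,
          show |((x - 1 : ℕ) : ℤ) - x| = 1 from (abs_eq (by norm_num)).mpr (by omega)⟩
    have hs_lt : s (peakPath H) < s (peakPath H') := by
      rw [lt_iff_le_not_ge, le_iff_of_gc hs, le_iff_of_gc hs, peakPath_le_iff, peakPath_le_iff,
        peakPath_height, peakPath_height, hxy, abs_sub_comm, hxy]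
      omega
    obtain ⟨k, l, g', G', hlt', hG'⟩ :=
      (isJoinIrred_peakPath_of_gc hs H' (by omega)).exists_eq_cone
    have hg' := ih H' (by omega) (by push_cast at hd; omega) G' hlt' hG'
    rw [hG, hG', lt_iff_le_not_ge, cone_le_iff, cone_le_iff, cone_val, cone_val] at hs_lt
    grind

/-- By `apex_le_of_gc` the lower adjoint maps the `n - 1` atoms, which are the paths with a peak of
height `2` at abscissa `2 (k + 1)`, injectively into the `n - 1` cones of apex `(k + 1, k + 1, 2)`,
hence onto them. -/
theorem exists_peakPath_eq_cone_of_gc (hs : ∀ p x, s p ≤ x ↔ p ≤ e (ConQuotient.mk c x))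
    {i : Fin (n + 1)} (G : IsApex i i 2) : ∃ P, s P = cone G := by
  have hpeak : ∀ k : Fin (n - 1), IsPeak (⟨2 * (k + 1), by omega⟩ : Fin (2 * n + 1)) 2 := by
    intro k
    constructor <;> push_cast <;> omega
  have hdiag : ∀ k : Fin (n - 1), IsApex (⟨k + 1, by omega⟩ : Fin (n + 1)) ⟨k + 1, by omega⟩ 2 := by
    intro k
    constructor <;> push_cast <;> first | omega | simp
  have key : ∀ k, ∃ l, s (peakPath (hpeak k)) = cone (hdiag l) := by
    intro k
    obtain ⟨i, j, g, G, hlt, hG⟩ :=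
      (isJoinIrred_peakPath_of_gc hs (hpeak k) le_rfl).exists_eq_cone
    have hk := k.isLt
    have hg := apex_le_of_gc hs (n - 2) (hpeak k) le_rfl (by omega) G hlt hG
    have h1 := G.parity
    have h2 := G.le_add
    have h3 := G.le_sub
    obtain ⟨rfl, hij⟩ : g = 2 ∧ (i : ℤ) = j := by grind
    obtain rfl : i = j := Fin.ext (by omega)
    have hi : i = ⟨(i - 1 : ℕ) + 1, by omega⟩ := Fin.ext (by dsimp only; omega)
    refine ⟨⟨i - 1, by omega⟩, hG.trans ?_⟩
    congr 1
  choose f hf using key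
  have hinj : Function.Injective f := by
    intro k l hkl
    have hle : peakPath (hpeak k) ≤ peakPath (hpeak l) :=
      (le_iff_of_gc hs).mp (by rw [hf, hf, hkl])
    rw [peakPath_le_iff, peakPath_height] at hle
    push_cast at hle
    exact Fin.ext (by grind)
  have h2 := G.le_add
  have h3 := G.le_sub
  obtain ⟨k, hk⟩ := Finite.surjective_of_injective hinj ⟨i - 1, by omega⟩
  have hi : i = ⟨(i - 1 : ℕ) + 1, by omega⟩ := Fin.ext (by dsimp only; omega)
  refine ⟨peakPath (hpeak k), (hf k).trans ?_⟩
  rw [hk]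
  congr 1 <;> exact hi.symm

end LowerAdjoint

/-- The cones of apex `(1, 1, 2)` and `(2, 2, 2)` are minima of their classes, hence so is their join,
whose entry in the second row and second column is `-1`. -/
theorem IsCatalan.exists_isClassMin_not_isPermutational {n : ℕ} (hn : 3 ≤ n)
    {c : LatticeCon (ASM n)} (hc : IsCatalan c) : ∃ A, IsClassMin c A ∧ ¬ A.IsPermutational := by
  obtain ⟨e⟩ := hc
  obtain ⟨s, hs⟩ := exists_gc_of_quotient_iso e
  let k : Fin n := ⟨1, by omega⟩
  have H1 : IsApex k.castSucc k.castSucc 2 := by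
    constructor <;> simp [k]
    omega
  have H2 : IsApex k.succ k.succ 2 := by
    constructor <;> simp [k]
    omega
  obtain ⟨P, hP⟩ := exists_peakPath_eq_cone_of_gc hs H1
  obtain ⟨Q, hQ⟩ := exists_peakPath_eq_cone_of_gc hs H2
  refine ⟨s P ⊔ s Q, isClassMin_sup_of_gc hs P Q, fun hperm => ?_⟩
  have h0 := ASM.isPermutational_iff_nonneg.mp hperm k k
  have h1 := (s P ⊔ s Q).two_mul_mat k k
  simp only [ASM.sup_val, hP, hQ, cone_val, Fin.val_succ, Fin.val_castSucc, k] at h0 h1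
  norm_num at h1
  omega

end AltSign

theorem mainTheorem7 (n : ℕ) :
    (∀ A : AltSign.ASM n, ¬ A.IsPermutational →
      ∃ A' : AltSign.ASM n, ¬ A'.IsPermutational ∧ (AltSign.joinands A').ncard = 2 ∧
        AltSign.joinands A' ⊆ AltSign.joinands A) ∧
    (∀ c : LatticeCon (AltSign.ASM n), List.TFAE [
      ∀ A : AltSign.ASM n, AltSign.IsClassMin c A → A.IsPermutational,
      ∀ A : AltSign.ASM n, ¬ A.IsPermutational → (AltSign.joinands A).ncard = 2 →
        ¬ AltSign.joinands A ⊆ AltSign.uncontracted c,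
      (AltSign.nonpermutationalGraph n).IsVertexCover {J | J.1 ∉ AltSign.uncontracted c}]) ∧
    (3 ≤ n → ∀ c : LatticeCon (AltSign.ASM n), AltSign.IsCatalan c →
      ∃ A : AltSign.ASM n, AltSign.IsClassMin c A ∧ ¬ A.IsPermutational) := by
  exact ⟨fun A hA => AltSign.exists_joinands_subset_ncard_eq_two hA,
    AltSign.tfae_forall_isClassMin_isPermutational,
    fun hn c hc => hc.exists_isClassMin_not_isPermutational hn⟩
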